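/- Let $\mathbb N=\{1,2,3,\dots\}$. For nonempty finite sets $s,t\subseteq\mathbb N$ write $s<t$ if $\max s<\min t$. A finite disjoint collection is a finite (possibly empty) sequence $\mathbf s=(s_1<\dots<s_k)$ of nonempty finite subsets of $\mathbb N$, and an infinite disjoint collection is an infinite sequence $\mathcal D=(s_1<s_2<\cdots)$ of nonempty finite subsets of $\mathbb N$. Let $\mathcal B^{<\omega}(\mathbb N)$ and $\mathcal B^{\omega}(\mathbb N)$ be the sets of all finite, respectively infinite, disjoint collections. For $\mathcal D\in\mathcal B^\omega(\mathbb N)$ let $FU(\mathcal D)$ be the family of all finite unions of members of $\mathcal D$, and for $\mathcal D_1,\mathcal D\in\mathcal B^\omega(\mathbb N)$ write $\mathcal D_1<\mathcal D$ if every member of $\mathcal D_1$ belongs to $FU(\mathcal D)$. For $\mathbf s\in\mathcal B^{<\omega}(\mathbb N)$ and $\mathcal D\in\mathcal B^\omega(\mathbb N)$ let $$[\mathbf s,\mathcal D]=\{\mathcal D_1\in\mathcal B^\omega(\mathbb N):\ \mathbf s \text{ is an initial segment of } \mathcal D_1 \text{ and every member of } \mathcal D_1 \text{ lying above } \textstyle\bigcup_{F\in\mathbf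 s}F \text{ belongs to } FU(\mathcal D)\},$$ where every set counts as lying above $\emptyset$. Let $\mathfrak T_E$, the block Ellentuck topology, be the topology on $\mathcal B^\omega(\mathbb N)$ with basic open sets $[\mathbf s,\mathcal D]$, for $\mathbf s\in\mathcal B^{<\omega}(\mathbb N)$ and $\mathcal D\in\mathcal B^\omega(\mathbb N)$. A family $\mathcal U\subseteq\mathcal B^\omega(\mathbb N)$ is completely Ramsey if for every $\mathbf s\in\mathcal B^{<\omega}(\mathbb N)$ and every $\mathcal D\in\mathcal B^\omega(\mathbb N)$ there is $\mathcal D_1\in\mathcal B^\omega(\mathbb N)$ with $\mathcal D_1<\mathcal D$ such that either $[\mathbf s,\mathcal D_1]\subseteq\mathcal U$ or $[\mathbf s,\mathcal D_1]\subseteq\mathcal B^\omega(\mathbb N)\setminus\mathcal U$. It has the Baire property in $\mathfrak T_E$ if it is the symmetric difference of a $\mathfrak T_E$-open set and a $\mathfrak T_E$-meager set. Corollary 4.7. A family $\mathcal U\subseteq\mathcal B^\omega(\mathbb N)$ is completely Ramsey if and only if it has the Baire property in the topology $\mathfrak T_E$. -/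

import Mathlib

namespace BlockEllentuck

/-- `s < t` for finite sets of positive integers: every element of `s` is below every element
of `t`. For nonempty `s` and `t` this says `max s < min t`. -/
def BlockLT (s t : Finset ℕ+) : Prop :=
  ∀ a ∈ s, ∀ b ∈ t, a < b

/-- Finite disjoint collections `s₁ < s₂ < ⋯ < sₖ` (possibly `k = 0`) of nonempty finite sets of
positive integers. -/
@[ext]
structure FinColl where
  blocks : List (Finset ℕ+)
  nonempty : ∀ F ∈ blocks, F.Nonempty
  increasing : blocks.Pairwise BlockLT

/-- Infinite disjoint collections `D₀ < D₁ < D₂ < ⋯` of nonempty finite sets of positive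
integers. -/
@[ext]
structure InfColl where
  block : ℕ → Finset ℕ+
  nonempty : ∀ n, (block n).Nonempty
  increasing : ∀ n, BlockLT (block n) (block (n + 1))

/-- The set of all finite unions of members of a family of finite sets. (The empty union is
allowed; this has no effect below, since only nonempty sets are ever tested for membership.) -/
def finiteUnions (C : Set (Finset ℕ+)) : Set (Finset ℕ+) :=
  {t | ∃ I : Finset (Finset ℕ+), (I : Set (Finset ℕ+)) ⊆ C ∧ t = I.biUnion id}

namespace FinColl

/-- The union of the members of a finite disjoint collection. -/
def union (s : FinColl) : Finset ℕ+ :=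
  s.blocks.toFinset.biUnion id

/-- `s ∝ D`: the finite collection `s` is an initial segment of the infinite collection `D`. -/
def IsInitialSegment (s : FinColl) (D : InfColl) : Prop :=
  s.blocks = (List.range s.blocks.length).map D.block

end FinColl

namespace InfColl

/-- An infinite disjoint collection as a set of finite sets. -/
def toSet (D : InfColl) : Set (Finset ℕ+) :=
  Set.range D.block

/-- `D - t`: the members of `D` that lie entirely above the finite set `t`. -/
def above (D : InfColl) (t : Finset ℕ+) : Set (Finset ℕ+) :=
  {F | F ∈ D.toSet ∧ BlockLT t F}

/-- `D₁ < D₂`: every member of `D₁` is a finite union of members of `D₂`. -/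
def Refines (D₁ D₂ : InfColl) : Prop :=
  D₁.toSet ⊆ finiteUnions D₂.toSet

/-- The basic set `[s, D]`: all infinite disjoint collections that start with `s` and whose
members above `⋃ s` are finite unions of members of `D`. -/
def basic (s : FinColl) (D : InfColl) : Set InfColl :=
  {E | s.IsInitialSegment E ∧ E.above s.union ⊆ finiteUnions D.toSet}

/-- The block Ellentuck topology, generated by the sets `[s, D]`. -/
instance ellentuckTopology : TopologicalSpace InfColl :=
  TopologicalSpace.generateFrom {V | ∃ (s : FinColl) (D : InfColl), V = basic s D}

/-- Completely Ramsey families of infinite disjoint collections. -/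
def CompletelyRamsey (U : Set InfColl) : Prop :=
  ∀ (s : FinColl) (D : InfColl), ∃ D₁ : InfColl, D₁.Refines D ∧
    (basic s D₁ ⊆ U ∨ basic s D₁ ⊆ Uᶜ)

end InfColl

end BlockEllentuck

/-!
For the implication from left to right, a nonempty basic set contained in the frontier of a
completely Ramsey family would contain a smaller one inside the interior of the family or of its
complement, which is absurd; so the frontier is nowhere dense.

For the converse, Hindman's theorem is applied in the free monoid on `Finset ℕ+`: the finite
products of the one-letter words `D₀, D₁, …` are the nonempty finite subsequences of `D`, so the
words produced by the theorem are again in block position. Any given `t` is accepted or rejected by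
some refinement of `D`, and fusion gives a single `E` that decides all `t` extending `s`. Once `s`
is rejected, Hindman's theorem propagates the rejection to the one-block extensions of `s`, hence to
all extensions, and a family that is open cannot meet `[s, E]` when all extensions are rejected.
Applied to complements of closed nowhere dense families this gives that those are Ramsey null, and
a further fusion shows that Ramsey null families form a σ-ideal.
-/

namespace BlockEllentuck

open Set

/-! ### Blocks and finite unions -/

theorem BlockLT.mono {s s' t t' : Finset ℕ+} (h : BlockLT s t) (hs : s' ⊆ s) (ht : t' ⊆ t) :
    BlockLT s' t' :=
  fun a ha b hb => h a (hs ha) b (ht hb)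

theorem BlockLT.trans {s t u : Finset ℕ+} (hst : BlockLT s t) (ht : t.Nonempty)
    (htu : BlockLT t u) : BlockLT s u := by
  obtain ⟨c, hc⟩ := ht
  exact fun a ha b hb => (hst a ha c hc).trans (htu c hc b hb)

theorem not_blockLT_self {s : Finset ℕ+} (hs : s.Nonempty) : ¬ BlockLT s s := by
  obtain ⟨a, ha⟩ := hs
  exact fun h => lt_irrefl a (h a ha a ha)

theorem blockLT_biUnion_left {ι : Type*} {I : Finset ι} {f : ι → Finset ℕ+} {t : Finset ℕ+} :
    BlockLT (I.biUnion f) t ↔ ∀ i ∈ I, BlockLT (f i) t := by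
  simp only [BlockLT, Finset.mem_biUnion]
  grind

theorem blockLT_biUnion_right {ι : Type*} {I : Finset ι} {f : ι → Finset ℕ+} {s : Finset ℕ+} :
    BlockLT s (I.biUnion f) ↔ ∀ i ∈ I, BlockLT s (f i) := by
  simp only [BlockLT, Finset.mem_biUnion]
  grind

theorem subset_finiteUnions (C : Set (Finset ℕ+)) : C ⊆ finiteUnions C :=
  fun F hF => ⟨{F}, by simpa using hF, by simp⟩

theorem union_mem_finiteUnions {C : Set (Finset ℕ+)} {F G : Finset ℕ+}
    (hF : F ∈ finiteUnions C) (hG : G ∈ finiteUnions C) : F ∪ G ∈ finiteUnions C := by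
  obtain ⟨I, hI, rfl⟩ := hF
  obtain ⟨J, hJ, rfl⟩ := hG
  exact ⟨I ∪ J, by simpa using ⟨hI, hJ⟩, by rw [Finset.union_biUnion]⟩

theorem biUnion_mem_finiteUnions {ι : Type*} {C : Set (Finset ℕ+)} {I : Finset ι}
    {f : ι → Finset ℕ+} (h : ∀ i ∈ I, f i ∈ finiteUnions C) : I.biUnion f ∈ finiteUnions C := by
  classical
  induction I using Finset.induction_on with
  | empty => exact ⟨∅, by simp, by simp⟩
  | insert i I _ ih =>
    rw [Finset.forall_mem_insert] at h
    rw [Finset.biUnion_insert]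
    exact union_mem_finiteUnions h.1 (ih h.2)

theorem finiteUnions_subset {C C' : Set (Finset ℕ+)} (h : C ⊆ finiteUnions C') :
    finiteUnions C ⊆ finiteUnions C' := by
  rintro _ ⟨I, hI, rfl⟩
  exact biUnion_mem_finiteUnions fun F hF => h (hI hF)

theorem mem_finiteUnions_setOf_blockLT {C : Set (Finset ℕ+)} {t F : Finset ℕ+}
    (hF : F ∈ finiteUnions C) (ht : BlockLT t F) : F ∈ finiteUnions {G | G ∈ C ∧ BlockLT t G} := by
  obtain ⟨I, hI, rfl⟩ := hF
  exact ⟨I, fun G hG => ⟨hI hG, blockLT_biUnion_right.1 ht G hG⟩, rfl⟩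

theorem exists_mem_of_mem_finiteUnions {C : Set (Finset ℕ+)} {F : Finset ℕ+}
    (hF : F ∈ finiteUnions C) {a : ℕ+} (ha : a ∈ F) : ∃ G ∈ C, a ∈ G := by
  obtain ⟨I, hI, rfl⟩ := hF
  obtain ⟨G, hG, haG⟩ := Finset.mem_biUnion.1 ha
  exact ⟨G, hI hG, haG⟩

/-! ### Finite collections -/

namespace FinColl

/-- The number of members of a finite disjoint collection. -/
abbrev length (s : FinColl) : ℕ := s.blocks.length

theorem mem_union {s : FinColl} {a : ℕ+} : a ∈ s.union ↔ ∃ F ∈ s.blocks, a ∈ F := by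
  simp [union]

theorem subset_union {s : FinColl} {F : Finset ℕ+} (hF : F ∈ s.blocks) : F ⊆ s.union :=
  fun _ ha => mem_union.2 ⟨F, hF, ha⟩

theorem blocks_nodup (s : FinColl) : s.blocks.Nodup := by
  refine s.increasing.imp_of_mem ?_
  rintro F _ hF - h rfl
  exact not_blockLT_self (s.nonempty F hF) h

theorem toFinset_blocks_injective :
    Function.Injective fun s : FinColl => s.blocks.toFinset := by
  intro s t hst
  ext1
  refine List.Perm.eq_of_pairwise (fun F G hF hG hFG hGF => ?_) s.increasing t.increasing
    (List.perm_of_nodup_nodup_toFinset_eq s.blocks_nodup t.blocks_nodup hst)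
  exact (not_blockLT_self (s.nonempty F hF) (hFG.trans (t.nonempty G hG) hGF)).elim

theorem finite_setOf_union_subset (M : Finset ℕ+) : {s : FinColl | s.union ⊆ M}.Finite := by
  refine Set.Finite.of_injOn (t := (M.powerset.powerset : Set (Finset (Finset ℕ+))))
    (fun s hs => ?_) toFinset_blocks_injective.injOn (Finset.finite_toSet _)
  simp only [Finset.mem_coe, Finset.mem_powerset]
  exact fun F hF => Finset.mem_powerset.2 ((subset_union (List.mem_toFinset.1 hF)).trans hs)

theorem finite_setOf_forall_exists_le (F : Finset ℕ+) :
    {s : FinColl | ∀ a ∈ s.union, ∃ b ∈ F, a ≤ b}.Finite := by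
  refine (finite_setOf_union_subset (F.biUnion fun b => Finset.Iic b)).subset ?_
  intro s hs a ha
  obtain ⟨b, hb, hab⟩ := hs a ha
  exact Finset.mem_biUnion.2 ⟨b, hb, Finset.mem_Iic.2 hab⟩

end FinColl

/-! ### Infinite collections -/

namespace InfColl

theorem blockLT_of_lt (D : InfColl) {i j : ℕ} (h : i < j) : BlockLT (D.block i) (D.block j) := by
  induction j, h using Nat.le_induction with
  | base => exact D.increasing i
  | succ j _ ih => exact ih.trans (D.nonempty j) (D.increasing j)

theorem block_mem_finiteUnions (D : InfColl) (n : ℕ) : D.block n ∈ finiteUnions D.toSet :=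
  subset_finiteUnions _ (mem_range_self n)

theorem refines_iff {D E : InfColl} : D.Refines E ↔ ∀ n, D.block n ∈ finiteUnions E.toSet :=
  range_subset_iff

theorem Refines.refl (D : InfColl) : D.Refines D := subset_finiteUnions _

theorem Refines.finiteUnions_subset {D E : InfColl} (h : D.Refines E) :
    finiteUnions D.toSet ⊆ finiteUnions E.toSet :=
  BlockEllentuck.finiteUnions_subset h

theorem Refines.trans {D E G : InfColl} (h : D.Refines E) (h' : E.Refines G) : D.Refines G :=
  Subset.trans h h'.finiteUnions_subset

theorem exists_finset_eq_biUnion {D : InfColl} {F : Finset ℕ+} (hF : F ∈ finiteUnions D.toSet) :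
    ∃ I : Finset ℕ, F = I.biUnion D.block := by
  obtain ⟨J, hJ, rfl⟩ := hF
  rw [toSet, ← image_univ, Finset.subset_set_image_iff] at hJ
  obtain ⟨I, -, rfl⟩ := hJ
  exact ⟨I, by simp only [Finset.image_biUnion, id]⟩

/-- The collection obtained by removing the first `k` blocks. -/
def drop (D : InfColl) (k : ℕ) : InfColl where
  block n := D.block (k + n)
  nonempty _ := D.nonempty _
  increasing _ := D.increasing _

theorem drop_refines (D : InfColl) (k : ℕ) : (D.drop k).Refines D :=
  refines_iff.2 fun n => D.block_mem_finiteUnions (k + n)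

theorem blockLT_of_mem_finiteUnions_drop (D : InfColl) {n : ℕ} {F : Finset ℕ+}
    (hF : F ∈ finiteUnions (D.drop (n + 1)).toSet) : BlockLT (D.block n) F := by
  intro a ha b hb
  obtain ⟨_, ⟨k, rfl⟩, hk⟩ := exists_mem_of_mem_finiteUnions hF hb
  exact D.blockLT_of_lt (Nat.lt_add_right k n.lt_succ_self) a ha b hk

theorem lt_of_mem_block (D : InfColl) (n : ℕ) : ∀ b ∈ D.block n, n < (b : ℕ) := by
  induction n with
  | zero => exact fun b _ => b.pos
  | succ n ih =>
    intro b hb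
    obtain ⟨a, ha⟩ := D.nonempty n
    exact lt_of_le_of_lt (ih a ha) (PNat.coe_lt_coe _ _ |>.2 (D.increasing n a ha b hb))

theorem exists_blockLT_drop (D : InfColl) (t : Finset ℕ+) :
    ∃ k, ∀ n, BlockLT t ((D.drop k).block n) := by
  refine ⟨t.sup (fun a => (a : ℕ)), fun n a ha b hb => ?_⟩
  rw [← PNat.coe_lt_coe]
  calc (a : ℕ) ≤ t.sup (fun a => (a : ℕ)) := Finset.le_sup (f := fun a : ℕ+ => (a : ℕ)) ha
    _ ≤ t.sup (fun a => (a : ℕ)) + n := Nat.le_add_right _ _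
    _ < b := D.lt_of_mem_block _ b hb

/-- `E` refines `D` above the finite set `t`; thus `[s, D]` consists of the collections that start
with `s` and refine `D` above `⋃ s`. -/
def RefinesAbove (t : Finset ℕ+) (E D : InfColl) : Prop :=
  E.above t ⊆ finiteUnions D.toSet

theorem Refines.refinesAbove {D E : InfColl} (h : E.Refines D) (t : Finset ℕ+) :
    RefinesAbove t E D :=
  fun _ hF => h hF.1

namespace RefinesAbove

variable {t t' : Finset ℕ+} {D E G : InfColl}

theorem mem_finiteUnions (h : RefinesAbove t E D) {F : Finset ℕ+} (hF : F ∈ finiteUnions E.toSet)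
    (ht : BlockLT t F) : F ∈ finiteUnions D.toSet :=
  finiteUnions_subset h (mem_finiteUnions_setOf_blockLT hF ht)

theorem trans (h : RefinesAbove t G E) (h' : RefinesAbove t E D) : RefinesAbove t G D :=
  fun _ hF => h'.mem_finiteUnions (h hF) hF.2

theorem mono (h : RefinesAbove t E D) (ht : t ⊆ t') : RefinesAbove t' E D :=
  fun _ hF => h ⟨hF.1, hF.2.mono ht Subset.rfl⟩

theorem exists_refines (h : RefinesAbove t E D) :
    ∃ E' : InfColl, E'.Refines E ∧ E'.Refines D := by
  obtain ⟨k, hk⟩ := E.exists_blockLT_drop t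
  exact ⟨E.drop k, E.drop_refines k,
    refines_iff.2 fun n => h.mem_finiteUnions (E.block_mem_finiteUnions (k + n)) (hk n)⟩

end RefinesAbove

/-- The finite collection of the first `n` blocks. -/
def take (D : InfColl) (n : ℕ) : FinColl where
  blocks := (List.range n).map D.block
  nonempty F hF := by
    obtain ⟨i, -, rfl⟩ := List.mem_map.1 hF
    exact D.nonempty i
  increasing := List.pairwise_map.2 (List.pairwise_lt_range.imp fun h => D.blockLT_of_lt h)

@[simp]
theorem length_take (D : InfColl) (n : ℕ) : (D.take n).length = n := by
  simp [take, FinColl.length]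

theorem mem_union_take {D : InfColl} {n : ℕ} {a : ℕ+} :
    a ∈ (D.take n).union ↔ ∃ i < n, a ∈ D.block i := by
  simp [FinColl.mem_union, take]

theorem union_take_mono (D : InfColl) {m n : ℕ} (h : m ≤ n) :
    (D.take m).union ⊆ (D.take n).union := by
  intro a ha
  obtain ⟨i, hi, hai⟩ := mem_union_take.1 ha
  exact mem_union_take.2 ⟨i, hi.trans_le h, hai⟩

theorem exists_mem_block_forall_le (D : InfColl) (n : ℕ) :
    ∃ a ∈ D.block n, ∀ b ∈ (D.take (n + 1)).union, b ≤ a := by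
  have hmax := (D.block n).max'_mem (D.nonempty n)
  refine ⟨_, hmax, fun b hb => ?_⟩
  obtain ⟨i, hi, hbi⟩ := mem_union_take.1 hb
  rcases (Nat.le_of_lt_succ hi).eq_or_lt with rfl | hlt
  · exact Finset.le_max' _ _ hbi
  · exact (D.blockLT_of_lt hlt b hbi _ hmax).le

theorem blockLT_union_take_iff (D : InfColl) {n i : ℕ} :
    BlockLT (D.take n).union (D.block i) ↔ n ≤ i := by
  refine ⟨fun h => not_lt.1 fun hi => ?_, fun h a ha => ?_⟩
  · exact not_blockLT_self (D.nonempty i)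
      (h.mono (fun a ha => mem_union_take.2 ⟨i, hi, ha⟩) Subset.rfl)
  · obtain ⟨j, hj, haj⟩ := mem_union_take.1 ha
    exact D.blockLT_of_lt (hj.trans_le h) a haj

theorem isInitialSegment_iff {s : FinColl} {D : InfColl} :
    s.IsInitialSegment D ↔ D.take s.length = s := by
  rw [FinColl.ext_iff, eq_comm]
  rfl

theorem take_eq_take_iff {D E : InfColl} {n : ℕ} :
    D.take n = E.take n ↔ ∀ i < n, D.block i = E.block i := by
  simp [FinColl.ext_iff, take]

/-- The infinite collection `s ⌢ D`, where `D` lies above `s`. It consists of the blocks of `s`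
followed by the blocks of `D` from index `s.length` on. -/
def append (s : FinColl) (D : InfColl) (hs : ∀ n, BlockLT s.union (D.block n)) : InfColl where
  block i := if h : i < s.length then s.blocks[i] else D.block i
  nonempty i := by
    split_ifs with h
    · exact s.nonempty _ (List.getElem_mem h)
    · exact D.nonempty i
  increasing i := by
    by_cases h : i + 1 < s.length
    · rw [dif_pos h, dif_pos (Nat.lt_of_succ_lt h)]
      exact List.pairwise_iff_getElem.1 s.increasing _ _ _ _ i.lt_succ_self
    · rw [dif_neg h]
      split_ifs with h'
      · exact (hs (i + 1)).mono (FinColl.subset_union (List.getElem_mem h')) Subset.rfl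
      · exact D.increasing i

theorem take_append (s : FinColl) (D : InfColl) (hs : ∀ n, BlockLT s.union (D.block n)) :
    (append s D hs).take s.length = s := by
  ext1
  refine List.ext_getElem (by simp [take]) fun i _ hi => ?_
  simp [take, append, hi]

theorem append_block_of_le {s : FinColl} {D : InfColl} (hs : ∀ n, BlockLT s.union (D.block n))
    {i : ℕ} (hi : s.length ≤ i) : (append s D hs).block i = D.block i :=
  dif_neg (not_lt.2 hi)

/-! ### Basic sets -/

theorem mem_basic {s : FinColl} {D E : InfColl} :
    E ∈ basic s D ↔
      E.take s.length = s ∧ ∀ i, s.length ≤ i → E.block i ∈ finiteUnions D.toSet := by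
  refine (and_congr_left' isInitialSegment_iff).trans (and_congr_right fun h => ?_)
  have hlt (i : ℕ) : BlockLT s.union (E.block i) ↔ s.length ≤ i := by
    rw [← E.blockLT_union_take_iff, h]
  constructor
  · exact fun hE i hi => hE ⟨mem_range_self i, (hlt i).2 hi⟩
  · rintro hE _ ⟨⟨i, rfl⟩, hi⟩
    exact hE i ((hlt i).1 hi)

section

variable {s : FinColl} {D E : InfColl}

theorem take_eq_of_mem_basic (h : E ∈ basic s D) : E.take s.length = s :=
  (mem_basic.1 h).1

theorem block_mem_finiteUnions_of_mem_basic (h : E ∈ basic s D) {i : ℕ} (hi : s.length ≤ i) :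
    E.block i ∈ finiteUnions D.toSet :=
  (mem_basic.1 h).2 i hi

theorem union_subset_union_take_of_mem_basic (h : E ∈ basic s D) {n : ℕ} (hn : s.length ≤ n) :
    s.union ⊆ (E.take n).union := by
  simpa only [take_eq_of_mem_basic h] using E.union_take_mono hn

theorem mem_basic_take (D : InfColl) (n : ℕ) : D ∈ basic (D.take n) D :=
  mem_basic.2 ⟨by rw [length_take], fun i _ => D.block_mem_finiteUnions i⟩

theorem mem_basic_take_of_mem_basic (h : E ∈ basic s D) {n : ℕ} (hn : s.length ≤ n) :
    E ∈ basic (E.take n) D := by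
  refine mem_basic.2 ⟨by rw [length_take], fun i hi => ?_⟩
  rw [length_take] at hi
  exact block_mem_finiteUnions_of_mem_basic h (hn.trans hi)

theorem RefinesAbove.basic_subset (h : RefinesAbove s.union E D) : basic s E ⊆ basic s D :=
  fun _ hG => ⟨hG.1, RefinesAbove.trans hG.2 h⟩

theorem Refines.basic_subset (h : E.Refines D) (s : FinColl) : basic s E ⊆ basic s D :=
  (h.refinesAbove s.union).basic_subset

theorem basic_take_subset (h : E ∈ basic s D) {n : ℕ} (hn : s.length ≤ n) :
    basic (E.take n) E ⊆ basic s D := by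
  intro G hG
  have hGE : G.take n = E.take n := by simpa only [length_take] using take_eq_of_mem_basic hG
  have hblock := take_eq_take_iff.1 hGE
  have hGs : G.take s.length = s :=
    (take_eq_take_iff.2 fun i hi => hblock i (hi.trans_le hn)).trans (take_eq_of_mem_basic h)
  refine mem_basic.2 ⟨hGs, fun i hi => ?_⟩
  rcases lt_or_ge i n with hin | hni
  · rw [hblock i hin]
    exact block_mem_finiteUnions_of_mem_basic h hi
  · have hGi : G.block i ∈ finiteUnions E.toSet :=
      block_mem_finiteUnions_of_mem_basic hG (by rwa [length_take])
    refine RefinesAbove.mem_finiteUnions h.2 hGi ?_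
    rw [← hGs]
    exact G.blockLT_union_take_iff.2 hi

end

theorem basic_nonempty (s : FinColl) (D : InfColl) : (basic s D).Nonempty := by
  obtain ⟨k, hs⟩ := D.exists_blockLT_drop s.union
  refine ⟨append s (D.drop k) hs, mem_basic.2 ⟨take_append _ _ hs, fun i hi => ?_⟩⟩
  rw [append_block_of_le hs hi]
  exact D.block_mem_finiteUnions (k + i)

theorem isTopologicalBasis_basic :
    TopologicalSpace.IsTopologicalBasis
      {V : Set InfColl | ∃ (s : FinColl) (D : InfColl), V = basic s D} where
  exists_subset_inter := by
    rintro _ ⟨s, D, rfl⟩ _ ⟨t, G, rfl⟩ E ⟨hEs, hEt⟩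
    exact ⟨_, ⟨E.take (max s.length t.length), E, rfl⟩, E.mem_basic_take _,
      subset_inter (basic_take_subset hEs (le_max_left _ _))
        (basic_take_subset hEt (le_max_right _ _))⟩
  sUnion_eq := eq_univ_of_forall fun E => ⟨_, ⟨E.take 0, E, rfl⟩, E.mem_basic_take 0⟩
  eq_generateFrom := rfl

theorem isOpen_basic (s : FinColl) (D : InfColl) : IsOpen (basic s D) :=
  isTopologicalBasis_basic.isOpen ⟨s, D, rfl⟩

end InfColl

/-! ### Hindman's theorem for disjoint collections -/

section Hindman

open Hindman

theorem exists_mem_FP_map_eq_sup {M α : Type*} [Semigroup M] [SemilatticeSup α] [OrderBot α]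
    {φ : M → α} (hφ : ∀ x y, φ (x * y) = φ x ⊔ φ y) (a : Stream' M) {I : Finset ℕ}
    (hI : I.Nonempty) : ∃ m ∈ FP a, φ m = I.sup fun i => φ (a.get i) := by
  suffices h : ∀ k, (∀ i ∈ I, k ≤ i) → ∃ m ∈ FP (a.drop k), φ m = I.sup fun i => φ (a.get i) from
    h 0 fun i _ => i.zero_le
  induction I using Finset.induction_on_min with
  | empty => exact absurd hI Finset.not_nonempty_empty
  | insert j I hj ih =>
    intro k hk
    obtain ⟨d, rfl⟩ := Nat.exists_eq_add_of_le (hk j (Finset.mem_insert_self j I))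
    have hsub : FP (a.drop (k + d)) ⊆ FP (a.drop k) := by
      rw [← Stream'.drop_drop]
      exact FP_drop_subset_FP _ d
    rcases I.eq_empty_or_nonempty with rfl | hI'
    · refine ⟨_, hsub (FP.head _), ?_⟩
      simp
    · obtain ⟨m, hm, hφm⟩ := ih hI' (k + d + 1) hj
      refine ⟨_, hsub (FP.cons _ m (by rwa [Stream'.tail_drop'])), ?_⟩
      rw [hφ, hφm, Finset.sup_insert, Stream'.head_drop]

theorem sublist_of_mem_FP_of {α : Type*} {d : ℕ → α} {w : FreeMonoid α}
    (hw : w ∈ FP fun n => FreeMonoid.of (d n)) :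
    w.toList ≠ [] ∧ ∃ n, w.toList.Sublist ((List.range n).map d) := by
  generalize ha : (fun n => FreeMonoid.of (d n)) = a at hw
  induction hw generalizing d with
  | head' a =>
    subst ha
    exact ⟨List.cons_ne_nil _ _, 1, .refl _⟩
  | tail' a w _ ih =>
    subst ha
    obtain ⟨hne, n, hn⟩ := ih (d := d ∘ Nat.succ) rfl
    refine ⟨hne, n + 1, ?_⟩
    rw [List.range_succ_eq_map, List.map_cons, List.map_map]
    exact hn.cons _
  | cons' a w _ ih =>
    subst ha
    obtain ⟨-, n, hn⟩ := ih (d := d ∘ Nat.succ) rfl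
    refine ⟨List.cons_ne_nil _ _, n + 1, ?_⟩
    rw [List.range_succ_eq_map, List.map_cons, List.map_map]
    exact hn.cons_cons _

/-- The union of the letters of a word whose letters are finite sets. -/
def wordUnion (w : FreeMonoid (Finset ℕ+)) : Finset ℕ+ :=
  w.toList.toFinset.biUnion id

theorem wordUnion_mul (v w : FreeMonoid (Finset ℕ+)) :
    wordUnion (v * w) = wordUnion v ⊔ wordUnion w := by
  rw [wordUnion, FreeMonoid.toList_mul, List.toFinset_append, Finset.union_biUnion]
  rfl

theorem blockLT_wordUnion {v w : FreeMonoid (Finset ℕ+)}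
    (h : (v * w).toList.Pairwise BlockLT) : BlockLT (wordUnion v) (wordUnion w) := by
  rw [FreeMonoid.toList_mul, List.pairwise_append] at h
  exact blockLT_biUnion_left.2 fun F hF => blockLT_biUnion_right.2 fun G hG =>
    h.2.2 F (List.mem_toFinset.1 hF) G (List.mem_toFinset.1 hG)

namespace InfColl

variable {D : InfColl} {w : FreeMonoid (Finset ℕ+)}

theorem pairwise_blockLT_of_mem_FP (hw : w ∈ FP fun n => FreeMonoid.of (D.block n)) :
    w.toList.Pairwise BlockLT := by
  obtain ⟨-, n, hn⟩ := sublist_of_mem_FP_of hw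
  exact (D.take n).increasing.sublist hn

theorem wordUnion_mem_of_mem_FP (hw : w ∈ FP fun n => FreeMonoid.of (D.block n)) :
    wordUnion w ∈ finiteUnions D.toSet := by
  obtain ⟨-, n, hn⟩ := sublist_of_mem_FP_of hw
  refine ⟨w.toList.toFinset, fun F hF => ?_, rfl⟩
  obtain ⟨i, -, rfl⟩ := List.mem_map.1 (hn.subset (List.mem_toFinset.1 hF))
  exact mem_range_self i

theorem wordUnion_nonempty_of_mem_FP (hw : w ∈ FP fun n => FreeMonoid.of (D.block n)) :
    (wordUnion w).Nonempty := by
  obtain ⟨hne, n, hn⟩ := sublist_of_mem_FP_of hw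
  obtain ⟨F, hF⟩ := List.exists_mem_of_ne_nil _ hne
  exact ((D.take n).nonempty F (hn.subset hF)).mono
    (Finset.subset_biUnion_of_mem id (List.mem_toFinset.2 hF))

theorem exists_refines_homogeneous (D : InfColl) (A : Set (Finset ℕ+)) :
    ∃ E : InfColl, E.Refines D ∧ ((∀ F ∈ finiteUnions E.toSet, F.Nonempty → F ∈ A) ∨
      ∀ F ∈ finiteUnions E.toSet, F.Nonempty → F ∉ A) := by
  let a : Stream' (FreeMonoid (Finset ℕ+)) := fun n => FreeMonoid.of (D.block n)
  let P := FP a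
  obtain ⟨c, hc, b, hbc⟩ := FP_partition_regular a {P ∩ wordUnion ⁻¹' A, P \ wordUnion ⁻¹' A}
    (toFinite _) (by rw [sUnion_pair, inter_union_sdiff])
  have hcP : c ⊆ P := by
    rcases hc with rfl | rfl
    exacts [inter_subset_left, sdiff_subset]
  have hb (n : ℕ) : b.get n ∈ P := hcP (hbc (FP.singleton b n))
  let E : InfColl :=
    { block := fun n => wordUnion (b.get n)
      nonempty := fun n => wordUnion_nonempty_of_mem_FP (hb n)
      increasing := fun n => blockLT_wordUnion
        (pairwise_blockLT_of_mem_FP (hcP (hbc (FP.mul_two b n (n + 1) n.lt_succ_self)))) }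
  have hE (F : Finset ℕ+) (hF : F ∈ finiteUnions E.toSet) (hne : F.Nonempty) :
      ∃ w ∈ c, wordUnion w = F := by
    obtain ⟨I, rfl⟩ := exists_finset_eq_biUnion hF
    obtain ⟨i, hi, -⟩ := Finset.biUnion_nonempty.1 hne
    obtain ⟨w, hw, hwI⟩ := exists_mem_FP_map_eq_sup wordUnion_mul b ⟨i, hi⟩
    exact ⟨w, hbc hw, hwI.trans (Finset.sup_eq_biUnion _ _)⟩
  refine ⟨E, refines_iff.2 fun n => wordUnion_mem_of_mem_FP (hb n), hc.imp ?_ ?_⟩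
  all_goals
    rintro rfl F hF hne
    obtain ⟨w, hw, rfl⟩ := hE F hF hne
    exact hw.2

end InfColl

end Hindman

namespace InfColl

/-! ### Fusion -/

theorem exists_refines_forall_mem {ι : Type*} {P : ι → InfColl → Prop} {S : Set ι}
    (hS : S.Finite) (hP : ∀ ⦃i D E⦄, E.Refines D → P i D → P i E)
    (hdense : ∀ i ∈ S, ∀ D, ∃ E : InfColl, E.Refines D ∧ P i E) (D : InfColl) :
    ∃ E : InfColl, E.Refines D ∧ ∀ i ∈ S, P i E := by
  induction S, hS using Set.Finite.induction_on with
  | empty => exact ⟨D, Refines.refl D, by simp⟩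
  | @insert i S _ _ ih =>
    rw [forall_mem_insert] at hdense
    obtain ⟨E, hED, hE⟩ := ih hdense.2
    obtain ⟨G, hGE, hG⟩ := hdense.1 E
    exact ⟨G, hGE.trans hED, forall_mem_insert.2 ⟨hG, fun j hj => hP hGE (hE j hj)⟩⟩

/-- The collection of the first blocks of a decreasing sequence of collections. -/
def diagonal (A : ℕ → InfColl) (hA : ∀ n, (A (n + 1)).Refines ((A n).drop 1)) : InfColl where
  block n := (A n).block 0
  nonempty n := (A n).nonempty 0
  increasing n := (A n).blockLT_of_mem_finiteUnions_drop (refines_iff.1 (hA n) 0)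

theorem diagonal_block_mem_finiteUnions {A : ℕ → InfColl}
    (hA : ∀ n, (A (n + 1)).Refines ((A n).drop 1)) {m n : ℕ} (h : m ≤ n) :
    (diagonal A hA).block n ∈ finiteUnions (A m).toSet := by
  have hmn : (A n).Refines (A m) := by
    induction n, h using Nat.le_induction with
    | base => exact Refines.refl _
    | succ n _ ih => exact ((hA n).trans (drop_refines _ _)).trans ih
  exact refines_iff.1 hmn 0

/-- A property of pairs `(s, D)` is hereditary if it is inherited by all `E` that refine `D` above
`⋃ s`. In particular it depends only on the part of `D` above `⋃ s`. -/
def Hereditary (P : FinColl → InfColl → Prop) : Prop :=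
  ∀ ⦃s : FinColl⦄ ⦃D E : InfColl⦄, RefinesAbove s.union E D → P s D → P s E

namespace Hereditary

variable {P : FinColl → InfColl → Prop}

theorem exists_refines_drop_forall (hP : Hereditary P)
    (hdense : ∀ s D, ∃ E : InfColl, E.Refines D ∧ P s E) (D : InfColl) :
    ∃ E : InfColl, E.Refines (D.drop 1) ∧
      ∀ s : FinColl, (∀ a ∈ s.union, ∃ b ∈ D.block 0, a ≤ b) → P s E := by
  have hPmono (s : FinColl) (A B : InfColl) (hBA : B.Refines A) (hA : P s A) : P s B :=
    hP (hBA.refinesAbove s.union) hA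
  exact exists_refines_forall_mem (P := P) (FinColl.finite_setOf_forall_exists_le (D.block 0))
    hPmono (fun s _ => hdense s) (D.drop 1)

/-- The hypotheses on `s` say that `E.block n` is the last block of `E` not lying above `⋃ s`. -/
theorem exists_refines_forall_bounded (hP : Hereditary P)
    (hdense : ∀ s D, ∃ E : InfColl, E.Refines D ∧ P s E) (D : InfColl) :
    ∃ E : InfColl, E.Refines D ∧ ∀ (s : FinColl) (n : ℕ),
      (∀ a ∈ s.union, ∃ b ∈ E.block n, a ≤ b) → ¬ BlockLT s.union (E.block n) → P s E := by
  choose f hf hfP using hP.exists_refines_drop_forall hdense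
  let A : ℕ → InfColl := fun n => f^[n] D
  have hAf (n : ℕ) : A (n + 1) = f (A n) := Function.iterate_succ_apply' f n D
  have hA (n : ℕ) : (A (n + 1)).Refines ((A n).drop 1) := hAf n ▸ hf (A n)
  refine ⟨diagonal A hA, refines_iff.2 fun n => diagonal_block_mem_finiteUnions hA n.zero_le,
    fun s n hsn hns => ?_⟩
  have hPs : P s (A (n + 1)) := hAf n ▸ hfP (A n) s hsn
  refine hP ?_ hPs
  rintro _ ⟨⟨m, rfl⟩, hsm⟩
  have hnm : n < m := by
    by_contra! hmn
    rcases hmn.eq_or_lt with rfl | hlt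
    · exact hns hsm
    · exact hns (hsm.trans (nonempty _ m) (blockLT_of_lt _ hlt))
  exact diagonal_block_mem_finiteUnions hA hnm

theorem exists_refines_forall_take (hP : Hereditary P)
    (hdense : ∀ s D, ∃ E : InfColl, E.Refines D ∧ P s E) (s : FinColl) (D : InfColl) :
    ∃ E : InfColl, E.Refines D ∧ ∀ G ∈ basic s E, ∀ n, s.length ≤ n → P (G.take n) E := by
  obtain ⟨D', hD'D, hD's⟩ := hdense s D
  obtain ⟨E, hED', hE⟩ := hP.exists_refines_forall_bounded hdense D'
  refine ⟨E, hED'.trans hD'D, fun G hG n hn => ?_⟩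
  rcases hn.eq_or_lt with rfl | hlt
  · rw [take_eq_of_mem_basic hG]
    exact hP (hED'.refinesAbove s.union) hD's
  obtain ⟨d, rfl⟩ := Nat.exists_eq_add_of_lt hlt
  obtain ⟨a, ha, hmax⟩ := G.exists_mem_block_forall_le (s.length + d)
  obtain ⟨_, ⟨j, rfl⟩, haj⟩ := exists_mem_of_mem_finiteUnions
    (block_mem_finiteUnions_of_mem_basic hG (Nat.le_add_right _ d)) ha
  exact hE _ j (fun c hc => ⟨a, haj, hmax c hc⟩) fun hlt =>
    lt_irrefl a (hlt a (mem_union_take.2 ⟨_, Nat.lt_succ_self _, ha⟩) a haj)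

end Hereditary

/-! ### Open families are completely Ramsey -/

/-- `D` rejects `s`, in the sense of Nash-Williams' combinatorial forcing: no refinement `E` of `D`
accepts `s`, where accepting means `[s, E] ⊆ U`. -/
def Rejects (U : Set InfColl) (s : FinColl) (D : InfColl) : Prop :=
  ∀ E : InfColl, E.Refines D → ¬ basic s E ⊆ U

theorem hereditary_accepts (U : Set InfColl) : Hereditary fun s D => basic s D ⊆ U :=
  fun _ _ _ h hU => h.basic_subset.trans hU

theorem hereditary_rejects (U : Set InfColl) : Hereditary (Rejects U) := by
  intro s D E h hrej G hGE hGU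
  obtain ⟨G', hG'G, hG'D⟩ := RefinesAbove.exists_refines ((hGE.refinesAbove s.union).trans h)
  exact hrej G' hG'D ((hG'G.basic_subset s).trans hGU)

theorem exists_refines_accepts_of_not_rejects {U : Set InfColl} {s : FinColl} {D : InfColl}
    (h : ¬ Rejects U s D) : ∃ E : InfColl, E.Refines D ∧ basic s E ⊆ U := by
  simpa only [Rejects, not_forall, not_not, exists_prop] using h

theorem exists_refines_forall_accepts_or_rejects (U : Set InfColl) (s : FinColl) (D : InfColl) :
    ∃ E : InfColl, E.Refines D ∧ ∀ G ∈ basic s E, ∀ n, s.length ≤ n →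
      basic (G.take n) E ⊆ U ∨ Rejects U (G.take n) E := by
  refine Hereditary.exists_refines_forall_take (P := fun t E => basic t E ⊆ U ∨ Rejects U t E)
    (fun t _ _ h => Or.imp (hereditary_accepts U h) (hereditary_rejects U h)) (fun t D => ?_) s D
  by_cases h : Rejects U t D
  · exact ⟨D, Refines.refl D, Or.inr h⟩
  · obtain ⟨E, hED, hE⟩ := exists_refines_accepts_of_not_rejects h
    exact ⟨E, hED, Or.inl hE⟩

theorem Rejects.exists_refines_forall_rejects_succ {U : Set InfColl} {s : FinColl} {D : InfColl}
    (h : Rejects U s D) : ∃ E : InfColl, E.Refines D ∧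
      ∀ G ∈ basic s E, Rejects U (G.take (s.length + 1)) E := by
  obtain ⟨D', hD'D, hD'⟩ := exists_refines_forall_accepts_or_rejects U s D
  obtain ⟨E, hED', hacc | hnacc⟩ := D'.exists_refines_homogeneous
    {F | ∃ G ∈ basic s D', G.block s.length = F ∧ basic (G.take (s.length + 1)) D' ⊆ U}
  · refine absurd (fun G hG => ?_) (h E (hED'.trans hD'D))
    obtain ⟨G', hG', hblock, hG'U⟩ := hacc (G.block s.length)
      (block_mem_finiteUnions_of_mem_basic hG le_rfl) (G.nonempty _)
    have htake : G'.take (s.length + 1) = G.take (s.length + 1) := by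
      have hs := (take_eq_of_mem_basic hG').trans (take_eq_of_mem_basic hG).symm
      exact take_eq_take_iff.2 (Nat.forall_lt_succ_right.2 ⟨take_eq_take_iff.1 hs, hblock⟩)
    refine hG'U ?_
    rw [htake]
    exact mem_basic_take_of_mem_basic (hED'.basic_subset s hG) (Nat.le_succ _)
  · refine ⟨E, hED'.trans hD'D, fun G hG => hereditary_rejects U (hED'.refinesAbove _) ?_⟩
    have hGD' := hED'.basic_subset s hG
    refine (hD' G hGD' _ (Nat.le_succ _)).resolve_left fun hGU => ?_
    exact hnacc (G.block s.length) (block_mem_finiteUnions_of_mem_basic hG le_rfl) (G.nonempty _)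
      ⟨G, hGD', rfl, hGU⟩

/-- Either `D` accepts `s`, or `D` rejects every one-block extension of `s` in `[s, D]`. -/
def AcceptsOrRejectsSucc (U : Set InfColl) (s : FinColl) (D : InfColl) : Prop :=
  basic s D ⊆ U ∨ ∀ G ∈ basic s D, Rejects U (G.take (s.length + 1)) D

theorem hereditary_acceptsOrRejectsSucc (U : Set InfColl) : Hereditary (AcceptsOrRejectsSucc U) :=
  fun _ _ _ h => Or.imp (hereditary_accepts U h) fun hrej G hG => hereditary_rejects U
    (h.mono (union_subset_union_take_of_mem_basic hG (Nat.le_succ _))) (hrej G (h.basic_subset hG))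

theorem exists_refines_acceptsOrRejectsSucc (U : Set InfColl) (s : FinColl) (D : InfColl) :
    ∃ E : InfColl, E.Refines D ∧ AcceptsOrRejectsSucc U s E := by
  by_cases h : Rejects U s D
  · obtain ⟨E, hED, hE⟩ := h.exists_refines_forall_rejects_succ
    exact ⟨E, hED, Or.inr hE⟩
  · obtain ⟨E, hED, hE⟩ := exists_refines_accepts_of_not_rejects h
    exact ⟨E, hED, Or.inl hE⟩

theorem exists_refines_accepts_or_forall_rejects (U : Set InfColl) (s : FinColl) (D : InfColl) :
    ∃ E : InfColl, E.Refines D ∧ (basic s E ⊆ U ∨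
      ∀ G ∈ basic s E, ∀ n, s.length < n → Rejects U (G.take n) E) := by
  obtain ⟨E, hED, hE⟩ := (hereditary_acceptsOrRejectsSucc U).exists_refines_forall_take
    (exists_refines_acceptsOrRejectsSucc U) s D
  refine ⟨E, hED, or_iff_not_imp_left.2 fun hs G hG n hn => ?_⟩
  have hsucc (n : ℕ) (hn : s.length ≤ n) (hacc : ¬ basic (G.take n) E ⊆ U) :
      Rejects U (G.take (n + 1)) E := by
    simpa only [length_take] using
      (hE G hG n hn).resolve_left hacc G (mem_basic_take_of_mem_basic hG hn)
  induction n, hn using Nat.le_induction with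
  | base => exact hsucc _ le_rfl (by rwa [take_eq_of_mem_basic hG])
  | succ n hn ih => exact hsucc n (Nat.le_of_succ_le hn) (ih E (Refines.refl E))

theorem completelyRamsey_of_isOpen {U : Set InfColl} (hU : IsOpen U) : CompletelyRamsey U := by
  intro s D
  obtain ⟨E, hED, hE⟩ := exists_refines_accepts_or_forall_rejects U s D
  refine ⟨E, hED, hE.imp_right fun hrej G hG hGU => ?_⟩
  obtain ⟨_, ⟨t, T, rfl⟩, hGT, hTU⟩ := isTopologicalBasis_basic.exists_subset_of_mem_open hGU hU
  let n := max (s.length + 1) t.length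
  have hsn : s.length < n := le_max_left (s.length + 1) t.length
  have hrejG : Rejects U (G.take n) G :=
    hereditary_rejects U (mem_basic_take_of_mem_basic hG hsn.le).2 (hrej G hG n hsn)
  exact hrejG G (Refines.refl G) ((basic_take_subset hGT (le_max_right _ _)).trans hTU)

/-! ### Ramsey null families -/

/-- A family is Ramsey null if every `[s, D]` contains, for some `E` refining `D`, a basic set
`[s, E]` that misses it. -/
def RamseyNull (N : Set InfColl) : Prop :=
  ∀ (s : FinColl) (D : InfColl), ∃ E : InfColl, E.Refines D ∧ Disjoint (basic s E) N

theorem RamseyNull.mono {M N : Set InfColl} (hN : RamseyNull N) (h : M ⊆ N) : RamseyNull M :=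
  fun s D => (hN s D).imp fun _ => And.imp_right (Disjoint.mono_right h)

theorem ramseyNull_of_isNowhereDense {N : Set InfColl} (hN : IsNowhereDense N) :
    RamseyNull N := by
  intro s D
  obtain ⟨E, hE, h | h⟩ := completelyRamsey_of_isOpen (isClosed_closure (s := N)).isOpen_compl s D
  · exact ⟨E, hE, (subset_compl_iff_disjoint_right.1 h).mono_right subset_closure⟩
  · rw [compl_compl] at h
    have hint := interior_maximal h (isOpen_basic s E)
    rw [hN] at hint
    exact absurd (hint (basic_nonempty s E).some_mem) (notMem_empty _)

theorem RamseyNull.sUnion {S : Set (Set InfColl)} (hS : S.Countable)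
    (h : ∀ N ∈ S, RamseyNull N) : RamseyNull (⋃₀ S) := by
  obtain ⟨f, hf⟩ := countable_iff_exists_injOn.1 hS
  have hfin (n : ℕ) : {N ∈ S | f N ≤ n}.Finite :=
    Set.Finite.of_injOn (fun _ hN => hN.2) (hf.mono fun _ hN => hN.1) (finite_Iic n)
  let P : FinColl → InfColl → Prop := fun t E => ∀ N ∈ {N ∈ S | f N ≤ t.length},
    Disjoint (basic t E) N
  have hP : Hereditary P := fun _ _ _ hED hD N hN => (hD N hN).mono_left hED.basic_subset
  have hdense (t : FinColl) : ∀ D, ∃ E : InfColl, E.Refines D ∧ P t E :=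
    exists_refines_forall_mem (hfin t.length)
      (fun _ _ _ hED hD => hD.mono_left (hED.basic_subset t)) fun N hN => h N hN.1 t
  intro s D
  obtain ⟨E, hED, hE⟩ := hP.exists_refines_forall_take hdense s D
  refine ⟨E, hED, disjoint_sUnion_right.2 fun N hN => Set.disjoint_left.2 fun G hG => ?_⟩
  have hn : s.length ≤ max s.length (f N) := le_max_left _ _
  have hNn : f N ≤ (G.take (max s.length (f N))).length := by simp
  exact Set.disjoint_left.1 (hE G hG _ hn N ⟨hN, hNn⟩) (mem_basic_take_of_mem_basic hG hn)

theorem ramseyNull_of_isMeagre {N : Set InfColl} (hN : IsMeagre N) : RamseyNull N := by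
  obtain ⟨S, hSN, hS, hNS⟩ := isMeagre_iff_countable_union_isNowhereDense.1 hN
  exact (RamseyNull.sUnion hS fun M hM => ramseyNull_of_isNowhereDense (hSN M hM)).mono hNS

/-! ### The Baire property -/

theorem CompletelyRamsey.congr {U V : Set InfColl} (hV : CompletelyRamsey V)
    (h : RamseyNull {G | ¬ (G ∈ U ↔ G ∈ V)}) : CompletelyRamsey U := by
  intro s D
  obtain ⟨D', hD'D, hD'⟩ := h s D
  obtain ⟨E, hED', hE⟩ := hV s D'
  have hiff {G : InfColl} (hG : G ∈ basic s E) : G ∈ U ↔ G ∈ V :=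
    not_not.1 (Set.disjoint_left.1 hD' (hED'.basic_subset s hG))
  exact ⟨E, hED'.trans hD'D, hE.imp (fun hEV G hG => (hiff hG).2 (hEV hG))
    fun hEV G hG hGU => hEV hG ((hiff hG).1 hGU)⟩

theorem completelyRamsey_of_baireMeasurableSet {U : Set InfColl} (hU : BaireMeasurableSet U) :
    CompletelyRamsey U := by
  obtain ⟨O, hO, hUO⟩ := hU.residualEq_isOpen
  refine (completelyRamsey_of_isOpen hO).congr (ramseyNull_of_isMeagre ?_)
  rw [IsMeagre, compl_ofPred]
  simpa only [not_not] using! Filter.eventuallyEq_set.1 hUO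

theorem CompletelyRamsey.isNowhereDense_frontier {U : Set InfColl} (hU : CompletelyRamsey U) :
    IsNowhereDense (frontier U) := by
  rw [isClosed_frontier.isNowhereDense_iff, eq_empty_iff_forall_notMem]
  intro E hE
  obtain ⟨_, ⟨s, D, rfl⟩, -, hD⟩ :=
    isTopologicalBasis_basic.exists_subset_of_mem_open hE isOpen_interior
  obtain ⟨D', hD'D, hD'⟩ := hU s D
  obtain ⟨G, hG⟩ := basic_nonempty s D'
  have hGfr : G ∈ frontier U := interior_subset (hD (hD'D.basic_subset s hG))
  rcases hD' with h | h
  · exact disjoint_interior_frontier.notMem_of_mem_left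
      (interior_maximal h (isOpen_basic s D') hG) hGfr
  · rw [← frontier_compl] at hGfr
    exact disjoint_interior_frontier.notMem_of_mem_left
      (interior_maximal h (isOpen_basic s D') hG) hGfr

theorem CompletelyRamsey.baireMeasurableSet {U : Set InfColl} (hU : CompletelyRamsey U) :
    BaireMeasurableSet U := by
  have hsdiff : U \ interior U ⊆ frontier U := sdiff_subset_sdiff_left subset_closure
  rw [← union_sdiff_cancel (interior_subset (s := U))]
  exact isOpen_interior.baireMeasurableSet.union
    (hU.isNowhereDense_frontier.mono hsdiff).isMeagre.baireMeasurableSet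

end InfColl

end BlockEllentuck

theorem corollary4p7 (U : Set BlockEllentuck.InfColl) :
    BlockEllentuck.InfColl.CompletelyRamsey U ↔ BaireMeasurableSet U :=
  ⟨fun h => h.baireMeasurableSet,
    BlockEllentuck.InfColl.completelyRamsey_of_baireMeasurableSet⟩
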